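/- All Banach spaces are real; $B_X$ is the closed unit ball of $X$. For every countable limit ordinal $\alpha$ fix an enumeration $(\beta_n)_{n\in\omega}$ of all ordinals less than $\alpha$ (the choice is arbitrary; the same choice is used in all the definitions below). **Sprawling trees.** Define sets $S_\alpha$ of finite sequences in $\{0,1\}\times\omega$ for $\alpha<\omega_1$ by $S_0=\{\varnothing\}$, $S_{\alpha+1}=\{\varnothing\}\cup\bigcup_{n\in\omega}\big((0,n)^\smallfrown S_\alpha\cup(1,n)^\smallfrown S_\alpha\big)$, and $S_\alpha=\{\varnothing\}\cup\bigcup_{n\in\omega}(0,n)^\smallfrown S_{\beta_n}$ for $\alpha$ limit. For $\delta>0$, a $\delta$-$\alpha$-sprawling tree is a family $(x_s)_{s\in S_\alpha}\subset X$ such that for every $s\in S_\alpha$: if $s$ has infinitely many successors $s^\smallfrown(0,n)$ and infinitely many successors $s^\smallfrown(1,n)$ in $S_\alpha$, then $x_s=\frac12(x_{s^\smallfrown(0,n)}+x_{s^\smallfrown(1,n)})$ for all $n$ and $\|x_{s^\smallfrown(0,n)}-x_{s^\smallfrown(0,m)}\|\ge\delta$ for all $n\ne m$; if $s$ has infinitely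 many successors $s^\smallfrown(0,n)$ and no successor $s^\smallfrown(1,n)$, then $x_s=x_{s^\smallfrown(0,n)}$ for all $n$. Let $ST(X,\delta)$ be the least $\alpha<\omega_1$ such that $B_X$ does not contain a $\delta$-$\alpha$-sprawling tree, and $ST(X,\delta)=\infty$ (larger than all ordinals) if there is none; let $ST(X)=\sup_{\delta>0}ST(X,\delta)$. The space $X$ has the Infinite Sprawling Tree Property if for some $\delta>0$ there is a map $f$ from the set of all finite sequences in $\{0,1\}\times\omega$ to $B_X$ such that for every $s$, $f(s)=\frac12(f(s^\smallfrown(0,n))+f(s^\smallfrown(1,n)))$ for all $n$ and $\|f(s^\smallfrown(0,n))-f(s^\smallfrown(0,m))\|\ge\delta$ for all $n\neq m$. **Diamond graphs.** The weighted graphs $D_\alpha^\omega$ ($\alpha<\omega_1$), with top $t_\alpha$, bottom $b_\alpha$ and a set $AP_\alpha$ of unordered pairs of vertices (the active pairs), are defined as follows. $D_0^\omega$ consists of $t_0,b_0$ joined by one edge of length $1$, and $AP_0=\{\{t_0,b_0\}\}$. $D_{\alpha+1}^\omega$ is obtained from the complete bipartite graph on the vertex classes $\{t_{\alpha+1},b_{\alpha+1}\}$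 and $\{x^j:j\in\omega\}$ by replacing each edge by a copy of $D_\alpha^\omega$ with all lengths multiplied by $\frac12$, the top and bottom of the copy being $t_{\alpha+1},x^j$ for the edge $\{t_{\alpha+1},x^j\}$ and $x^j,b_{\alpha+1}$ for the edge $\{x^j,b_{\alpha+1}\}$; $AP_{\alpha+1}$ consists of all pairs of distinct elements of $\{t_{\alpha+1},b_{\alpha+1}\}\cup\{x^j:j\in\omega\}$ and of the active pairs of all the copies of $D_\alpha^\omega$. For $\alpha$ limit, $D_\alpha^\omega$ is the disjoint union of the $D_{\beta_n}^\omega$, $n\in\omega$, with all the tops identified to $t_\alpha$ and all the bottoms identified to $b_\alpha$, and $AP_\alpha=\bigcup_n AP_{\beta_n}$. Let $d_\alpha$ be the shortest path metric of $D_\alpha^\omega$. We say that $D_\alpha^\omega$ sub-Lipschitz embeds into $X$ if there are $A,B>0$ and $f:D_\alpha^\omega\to X$ with $A\,d_\alpha(u,v)\le\|f(u)-f(v)\|\le B\,d_\alpha(u,v)$ for all $\{u,v\}\in AP_\alpha$. **Theorem B.** Let $X$ be a separable Banach space and $\alpha\in(0,\omega_1)$. Let $Y$ be a Banach space that bi-Lipschitz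 embeds into $X$. Then 1. $ST(X)>\alpha$ if and only if $D_\alpha^\omega$ sub-Lipschitz embeds into $X$; 2. $ST(Y)\le ST(X)$; 3. if $X$ fails the Infinite Sprawling Tree Property, so does $Y$. -/

import Mathlib

open Ordinal

/-! ### Enumerations of the ordinals below a countable limit ordinal -/

/-- A choice, for every limit ordinal `α`, of a sequence of ordinals less than `α` which, when `α`
is countable, enumerates all the ordinals less than `α`. (For uncountable `α` the sequence
is irrelevant: it is never used below.) -/
structure LimitEnumeration where
  /-- the `n`-th ordinal in the chosen enumeration of the ordinals less than `α` -/
  seq : ∀ α : Ordinal.{0}, Order.IsSuccLimit α → ℕ → Set.Iio α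
  surjective : ∀ (α : Ordinal.{0}) (hα : Order.IsSuccLimit α), α < ω_ 1 →
    Function.Surjective (seq α hα)

/-- Such choices of enumerations exist. -/
theorem limitEnumeration_nonempty : Nonempty LimitEnumeration := by
  have key : ∀ (α : Ordinal.{0}), Order.IsSuccLimit α →
      ∃ f : ℕ → Set.Iio α, α < ω_ 1 → Function.Surjective f := by
    intro α h
    have : Nonempty (Set.Iio α) := ⟨⟨0, by simpa using h.bot_lt⟩⟩
    by_cases hα : α < ω_ 1
    · have : Countable (Set.Iio α) := by
        rw [← Cardinal.mk_le_aleph0_iff, Cardinal.mk_Iio_ordinal, Cardinal.lift_le_aleph0,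
          ← Cardinal.lt_aleph_one_iff]
        rwa [← Cardinal.ord_aleph, Cardinal.lt_ord] at hα
      obtain ⟨f, hf⟩ := exists_surjective_nat (Set.Iio α)
      exact ⟨f, fun _ => hf⟩
    · exact ⟨fun _ => Classical.arbitrary _, fun h => absurd h hα⟩
  choose f hf using key
  exact ⟨⟨f, hf⟩⟩

/-! ### Sprawling trees -/

/-- Finite sequences in `{0,1} × ω`. -/
abbrev SprawlSeq : Type := List (Fin 2 × ℕ)

/-- The tree `S_α` of finite sequences in `{0,1} × ω`. -/
noncomputable def sprawlingIndexTree (β : LimitEnumeration) (α : Ordinal.{0}) : Set SprawlSeq :=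
  Ordinal.limitRecOn (motive := fun _ => Set SprawlSeq) α
    {[]}
    (fun _ S => {[]} ∪ ⋃ n : ℕ, (List.cons ((0, n) : Fin 2 × ℕ) '' S ∪
      List.cons ((1, n) : Fin 2 × ℕ) '' S))
    (fun γ hγ S => {[]} ∪ ⋃ n : ℕ,
      List.cons ((0, n) : Fin 2 × ℕ) '' S (β.seq γ hγ n) (β.seq γ hγ n).2)

/-- The family `(x_s)`, `s ∈ S_α`, is a `δ`-`α`-sprawling tree of `X`.
(The values of `x` outside `S_α` are irrelevant.) -/
def IsSprawlingTree {X : Type*} [NormedAddCommGroup X] [NormedSpace ℝ X]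
    (β : LimitEnumeration) (δ : ℝ) (α : Ordinal.{0}) (x : SprawlSeq → X) : Prop :=
  ∀ s ∈ sprawlingIndexTree β α,
    ({n : ℕ | s ++ [(0, n)] ∈ sprawlingIndexTree β α}.Infinite →
      {n : ℕ | s ++ [(1, n)] ∈ sprawlingIndexTree β α}.Infinite →
        (∀ n : ℕ, x s = (1 / 2 : ℝ) • (x (s ++ [(0, n)]) + x (s ++ [(1, n)]))) ∧
        (∀ n m : ℕ, n ≠ m → δ ≤ ‖x (s ++ [(0, n)]) - x (s ++ [(0, m)])‖)) ∧
    ({n : ℕ | s ++ [(0, n)] ∈ sprawlingIndexTree β α}.Infinite →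
      {n : ℕ | s ++ [(1, n)] ∈ sprawlingIndexTree β α} = ∅ →
        ∀ n : ℕ, x s = x (s ++ [(0, n)]))

/-- The closed unit ball of `X` contains a `δ`-`α`-sprawling tree. -/
def BallContainsSprawlingTree (β : LimitEnumeration) (X : Type*) [NormedAddCommGroup X]
    [NormedSpace ℝ X] (δ : ℝ) (α : Ordinal.{0}) : Prop :=
  ∃ x : SprawlSeq → X, IsSprawlingTree β δ α x ∧
    ∀ s ∈ sprawlingIndexTree β α, x s ∈ Metric.closedBall (0 : X) 1

/-- `ST(X, δ)`: the least countable ordinal `α` such that the unit ball of `X` contains no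
`δ`-`α`-sprawling tree, and `∞` (that is, `⊤`) if there is none. -/
noncomputable def sprawlingIndexAt (β : LimitEnumeration) (X : Type*) [NormedAddCommGroup X]
    [NormedSpace ℝ X] (δ : ℝ) : WithTop Ordinal.{0} :=
  ⨅ α ∈ {α : Ordinal.{0} | α < ω_ 1 ∧ ¬ BallContainsSprawlingTree β X δ α},
    (α : WithTop Ordinal.{0})

/-- The sprawling-tree index `ST(X)`, the supremum of the `ST(X, δ)`, `δ > 0`. -/
noncomputable def sprawlingIndex (β : LimitEnumeration) (X : Type*) [NormedAddCommGroup X]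
    [NormedSpace ℝ X] : WithTop Ordinal.{0} :=
  ⨆ δ ∈ Set.Ioi (0 : ℝ), sprawlingIndexAt β X δ

/-! ### The Infinite Sprawling Tree Property -/

/-- The restriction of `f` to the set `A_k` of sequences of length at most `k` takes values in the
unit ball of `X` and belongs to the tree `ST(X, δ)`. -/
def IsFiniteSprawlingTree {X : Type*} [NormedAddCommGroup X] [NormedSpace ℝ X]
    (δ : ℝ) (k : ℕ) (f : SprawlSeq → X) : Prop :=
  (∀ s : SprawlSeq, s.length ≤ k → f s ∈ Metric.closedBall (0 : X) 1) ∧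
  ∀ s : SprawlSeq, s.length + 1 ≤ k →
    (∀ n : ℕ, f s = (1 / 2 : ℝ) • (f (s ++ [(0, n)]) + f (s ++ [(1, n)]))) ∧
    (∀ n m : ℕ, n ≠ m → δ ≤ ‖f (s ++ [(0, n)]) - f (s ++ [(0, m)])‖)

/-- The Infinite Sprawling Tree Property. -/
def InfiniteSprawlingTreeProperty (X : Type*) [NormedAddCommGroup X] [NormedSpace ℝ X] : Prop :=
  ∃ δ : ℝ, 0 < δ ∧ ∃ f : SprawlSeq → X, ∀ k : ℕ, IsFiniteSprawlingTree δ k f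

/-! ### Countably branching diamond graphs -/

/-- The vertices of a diamond graph: the top, the bottom, and the inner vertices. -/
inductive DiamondVertex (I : Type) : Type
  | top : DiamondVertex I
  | bot : DiamondVertex I
  | inner : I → DiamondVertex I

/-- A weighted graph with a distinguished top and bottom, together with a set of unordered pairs
of vertices, called active pairs. Several weighted edges between two vertices are
allowed. -/
structure Diamond where
  /-- the type of vertices other than the top and the bottom -/
  Inner : Type
  /-- `Edge e ℓ` means that there is an edge of length `ℓ` joining the two vertices in `e` -/
  Edge : Sym2 (DiamondVertex Inner) → ℝ → Prop
  /-- the set of active pairs -/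
  active : Set (Sym2 (DiamondVertex Inner))

namespace Diamond

/-- The set of vertices. -/
abbrev Vertex (D : Diamond) : Type := DiamondVertex D.Inner

/-- `D.Walk u v L` means that there is a walk of total length `L` from `u` to `v` in `D`. -/
inductive Walk (D : Diamond) : D.Vertex → D.Vertex → ℝ → Prop
  | nil (u : D.Vertex) : Walk D u u 0
  | cons {u v w : D.Vertex} {ℓ L : ℝ} (h : D.Edge s(u, v) ℓ) (p : Walk D v w L) :
      Walk D u w (ℓ + L)

/-- The shortest path metric of the weighted graph `D`. -/
noncomputable def dist (D : Diamond) (u v : D.Vertex) : ℝ := sInf {L : ℝ | D.Walk u v L}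

/-- The diamond graph `D_0`: two vertices, joined by an edge of length `1`, which form
the only active pair. -/
def zero : Diamond where
  Inner := Empty
  Edge e ℓ := e = s(.top, .bot) ∧ ℓ = 1
  active := {s(.top, .bot)}

/-- The inner vertices of `D_{α+1}`, where `I` is the set of inner vertices of `D_α`: the middle
vertices `x^j` of the original `D_1`, and the inner vertices of the copies of `D_α` that
replace the edges `(j, +)` and `(j, -)` of the original `D_1`. -/
inductive SuccInner (I : Type) : Type
  | mid (j : ℕ) : SuccInner I
  | upper (j : ℕ) (p : I) : SuccInner I
  | lower (j : ℕ) (p : I) : SuccInner I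

/-- The inclusion into `D_{α+1}` of the copy of `D_α` replacing the edge `(j, +)` from the
top to `x^j`. -/
def upperCopy {I : Type} (j : ℕ) : DiamondVertex I → DiamondVertex (SuccInner I)
  | .top => .top
  | .bot => .inner (.mid j)
  | .inner p => .inner (.upper j p)

/-- The inclusion into `D_{α+1}` of the copy of `D_α` replacing the edge `(j, -)` from `x^j`
to the bottom. -/
def lowerCopy {I : Type} (j : ℕ) : DiamondVertex I → DiamondVertex (SuccInner I)
  | .top => .inner (.mid j)
  | .bot => .bot
  | .inner p => .inner (.lower j p)

/-- The vertices of the original `D_1` in `D_{α+1}`. -/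
def originalVertices (I : Type) : Set (DiamondVertex (SuccInner I)) :=
  {.top, .bot} ∪ Set.range (fun j : ℕ => .inner (.mid j))

/-- The construction of `D_{α+1}` from `D_α`: every edge of `D_1` is replaced by a copy of `D_α`
scaled by the factor `1/2`. The active pairs are all pairs of distinct vertices of
the original `D_1`, and the active pairs of the copies of `D_α`. -/
def succ (D : Diamond) : Diamond where
  Inner := SuccInner D.Inner
  Edge e ℓ := ∃ (e' : Sym2 D.Vertex) (ℓ' : ℝ) (j : ℕ), D.Edge e' ℓ' ∧ ℓ = ℓ' / 2 ∧
    (e = e'.map (upperCopy j) ∨ e = e'.map (lowerCopy j))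
  active :=
    {e | ∃ u ∈ originalVertices D.Inner, ∃ v ∈ originalVertices D.Inner, u ≠ v ∧ e = s(u, v)} ∪
    ⋃ j : ℕ, (Sym2.map (upperCopy j) '' D.active ∪ Sym2.map (lowerCopy j) '' D.active)

/-- The inclusion of the `n`-th piece in a disjoint union whose tops and whose bottoms have been
identified. -/
def pieceIncl {I : ℕ → Type} (n : ℕ) : DiamondVertex (I n) → DiamondVertex (Σ n, I n)
  | .top => .top
  | .bot => .bot
  | .inner p => .inner ⟨n, p⟩

/-- The disjoint union of a sequence of diamond graphs, in which all tops are identified and all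
bottoms are identified. -/
def union (D : ℕ → Diamond) : Diamond where
  Inner := Σ n, (D n).Inner
  Edge e ℓ := ∃ (n : ℕ) (e' : Sym2 (D n).Vertex), (D n).Edge e' ℓ ∧
    e = e'.map (pieceIncl (I := fun n => (D n).Inner) n)
  active := ⋃ n : ℕ, Sym2.map (pieceIncl (I := fun n => (D n).Inner) n) '' (D n).active

/-- The diamond graph `D` sub-Lipschitz embeds into `X`: some map from its vertices to `X` is
bi-Lipschitz on active pairs. -/
def SubLipschitzEmbeds (D : Diamond) (X : Type*) [NormedAddCommGroup X] : Prop :=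
  ∃ A B : ℝ, 0 < A ∧ 0 < B ∧ ∃ f : D.Vertex → X, ∀ u v : D.Vertex, s(u, v) ∈ D.active →
    A * D.dist u v ≤ ‖f u - f v‖ ∧ ‖f u - f v‖ ≤ B * D.dist u v

end Diamond

/-- The countably branching diamond graph `D_α^ω`. -/
noncomputable def omegaDiamond (β : LimitEnumeration) (α : Ordinal.{0}) : Diamond :=
  Ordinal.limitRecOn (motive := fun _ => Diamond) α
    Diamond.zero
    (fun _ D => D.succ)
    (fun γ hγ D => Diamond.union fun n => D (β.seq γ hγ n) (β.seq γ hγ n).2)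

/-! ### Bi-Lipschitz embeddings -/

/-- The metric space `Y` bi-Lipschitz embeds into the metric space `X`. -/
def BiLipschitzEmbeds (Y X : Type*) [PseudoEMetricSpace Y] [PseudoEMetricSpace X] : Prop :=
  ∃ (f : Y → X) (K K' : NNReal), LipschitzWith K f ∧ AntilipschitzWith K' f

/-! A sprawling tree is the derivative of a map on a diamond graph. Given a map `f` on `D_α`, put `f
t - f b` at the root and, recursively, the same vector for each half-scale copy, multiplied by 2.
The telescoping sum `t`, `x^n`, `b` is the midpoint identity, and `d(x^n, x^m) = 1` gives the
separation (`exists_sprawlingTree_of_subLipschitzWith`). Conversely, a tree is integrated from the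
bottom upwards (`exists_subLipschitzWith_of_sprawlingTree`). This uses a lower bound on the norms of
the tree, obtained by translating it by a long vector (`exists_norm_ge`). Only distances inside one
copy and between the vertices of the original `D_1` enter. They are computed by extending
1-Lipschitz functions from a copy to the whole graph.

The sub-Lipschitz condition is purely metric, so it survives composition with a bi-Lipschitz `F : Y
→ X`. Passing from tree to diamond in `Y`, then from diamond to tree in `X`, changes `δ` by an
amount independent of `α`, whence part 2 (`sprawlingIndexAt_le_of_biLipschitz`).

For infinite trees there is no limiting graph to pass through. The difference quotients of `F` along
an infinite tree of `Y` are taken directly (`diffQuotientTree`), and the same telescoping and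
separation arguments apply. -/

/-! ### Recursive description of sprawling trees -/

section Trees

variable {X : Type*} [NormedAddCommGroup X] [NormedSpace ℝ X] (β : LimitEnumeration)

theorem sprawlingIndexTree_zero : sprawlingIndexTree β 0 = {[]} := by
  simp [sprawlingIndexTree]

theorem sprawlingIndexTree_add_one (γ : Ordinal.{0}) :
    sprawlingIndexTree β (γ + 1) = {[]} ∪ ⋃ n : ℕ,
      (List.cons ((0, n) : Fin 2 × ℕ) '' sprawlingIndexTree β γ ∪
        List.cons ((1, n) : Fin 2 × ℕ) '' sprawlingIndexTree β γ) := by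
  simp only [sprawlingIndexTree, limitRecOn_add_one]

theorem sprawlingIndexTree_limit (γ : Ordinal.{0}) (hγ : Order.IsSuccLimit γ) :
    sprawlingIndexTree β γ = {[]} ∪ ⋃ n : ℕ,
      List.cons ((0, n) : Fin 2 × ℕ) '' sprawlingIndexTree β (β.seq γ hγ n) := by
  simp only [sprawlingIndexTree, limitRecOn_limit (h := hγ)]

theorem nil_mem_sprawlingIndexTree (α : Ordinal.{0}) : [] ∈ sprawlingIndexTree β α := by
  induction α using Ordinal.limitRecOn with
  | zero => simp [sprawlingIndexTree_zero]
  | add_one γ _ => simp [sprawlingIndexTree_add_one]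
  | limit γ hγ _ => simp [sprawlingIndexTree_limit β γ hγ]

theorem cons_mem_sprawlingIndexTree_add_one {γ : Ordinal.{0}} {i : Fin 2} {n : ℕ}
    {s : SprawlSeq} :
    (i, n) :: s ∈ sprawlingIndexTree β (γ + 1) ↔ s ∈ sprawlingIndexTree β γ := by
  rw [sprawlingIndexTree_add_one]
  fin_cases i <;> simp

theorem zero_cons_mem_sprawlingIndexTree_limit {γ : Ordinal.{0}} (hγ : Order.IsSuccLimit γ)
    {n : ℕ} {s : SprawlSeq} :
    (0, n) :: s ∈ sprawlingIndexTree β γ ↔ s ∈ sprawlingIndexTree β (β.seq γ hγ n) := by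
  rw [sprawlingIndexTree_limit β γ hγ]
  simp

theorem one_cons_notMem_sprawlingIndexTree_limit {γ : Ordinal.{0}} (hγ : Order.IsSuccLimit γ)
    {n : ℕ} {s : SprawlSeq} : (1, n) :: s ∉ sprawlingIndexTree β γ := by
  rw [sprawlingIndexTree_limit β γ hγ]
  simp

theorem isSprawlingTree_zero (δ : ℝ) (x : SprawlSeq → X) : IsSprawlingTree β δ 0 x := by
  intro s _
  simp [sprawlingIndexTree_zero]

/-- The root has all successors of both kinds, so its conditions become unconditional; the
conditions at `(i, n) :: s` are those at `s` in the subtree. -/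
theorem isSprawlingTree_add_one {δ : ℝ} {γ : Ordinal.{0}} {x : SprawlSeq → X} :
    IsSprawlingTree β δ (γ + 1) x ↔
      (∀ n : ℕ, x [] = (1 / 2 : ℝ) • (x [(0, n)] + x [(1, n)])) ∧
      (∀ n m : ℕ, n ≠ m → δ ≤ ‖x [(0, n)] - x [(0, m)]‖) ∧
      ∀ (i : Fin 2) (n : ℕ), IsSprawlingTree β δ γ (fun s => x ((i, n) :: s)) := by
  have hroot := nil_mem_sprawlingIndexTree β γ
  constructor
  · intro h
    have h0 := (h [] (nil_mem_sprawlingIndexTree β _)).1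
    simp only [List.nil_append, cons_mem_sprawlingIndexTree_add_one, hroot, Set.ofPred_true,
      Set.infinite_univ, true_imp_iff] at h0
    refine ⟨h0.1, h0.2, fun i n s hs => ?_⟩
    have := h ((i, n) :: s) ((cons_mem_sprawlingIndexTree_add_one β).2 hs)
    simpa only [List.cons_append, cons_mem_sprawlingIndexTree_add_one] using this
  · rintro ⟨h1, h2, h3⟩ (_ | ⟨⟨i, n⟩, s⟩) hs
    · simp only [List.nil_append, cons_mem_sprawlingIndexTree_add_one, hroot, Set.ofPred_true]
      exact ⟨fun _ _ => ⟨h1, h2⟩, fun _ h => absurd h Set.univ_nonempty.ne_empty⟩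
    · have := h3 i n s ((cons_mem_sprawlingIndexTree_add_one β).1 hs)
      simpa only [List.cons_append, cons_mem_sprawlingIndexTree_add_one] using this

theorem isSprawlingTree_limit {δ : ℝ} {γ : Ordinal.{0}} (hγ : Order.IsSuccLimit γ)
    {x : SprawlSeq → X} :
    IsSprawlingTree β δ γ x ↔
      (∀ n : ℕ, x [] = x [(0, n)]) ∧
      ∀ n : ℕ, IsSprawlingTree β δ (β.seq γ hγ n) (fun s => x ((0, n) :: s)) := by
  constructor
  · intro h
    have h0 := (h [] (nil_mem_sprawlingIndexTree β _)).2
    simp only [List.nil_append, zero_cons_mem_sprawlingIndexTree_limit β hγ,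
      one_cons_notMem_sprawlingIndexTree_limit β hγ, nil_mem_sprawlingIndexTree, Set.ofPred_true,
      Set.ofPred_false, Set.infinite_univ, true_imp_iff] at h0
    refine ⟨h0, fun n s hs => ?_⟩
    have := h ((0, n) :: s) ((zero_cons_mem_sprawlingIndexTree_limit β hγ).2 hs)
    simpa only [List.cons_append, zero_cons_mem_sprawlingIndexTree_limit β hγ] using this
  · rintro ⟨h1, h2⟩ (_ | ⟨⟨i, n⟩, s⟩) hs
    · simp only [List.nil_append, one_cons_notMem_sprawlingIndexTree_limit β hγ, Set.ofPred_false]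
      exact ⟨fun _ h => absurd Set.finite_empty h, fun _ _ => h1⟩
    · obtain rfl | rfl : i = 0 ∨ i = 1 := by omega
      · have := h2 n s ((zero_cons_mem_sprawlingIndexTree_limit β hγ).1 hs)
        simpa only [List.cons_append, zero_cons_mem_sprawlingIndexTree_limit β hγ] using this
      · exact absurd hs (one_cons_notMem_sprawlingIndexTree_limit β hγ)

/-! ### The sprawling-tree index -/

/-- Subtrees have smaller rank, and every smaller rank is reached: at a limit, `γ` is some `β_n`
since the enumeration of a countable ordinal is onto. -/
theorem BallContainsSprawlingTree.mono {δ : ℝ} {α γ : Ordinal.{0}} (hα : α < ω_ 1)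
    (h : BallContainsSprawlingTree β X δ α) (hγ : γ ≤ α) :
    BallContainsSprawlingTree β X δ γ := by
  induction α using Ordinal.limitRecOn with
  | zero => rwa [nonpos_iff_eq_zero.1 hγ]
  | add_one η ih =>
    rcases hγ.eq_or_lt with rfl | hlt
    · exact h
    · obtain ⟨x, hx, hb⟩ := h
      refine ih ((Order.lt_add_one_iff.2 le_rfl).trans hα)
        ⟨_, ((isSprawlingTree_add_one β).1 hx).2.2 0 0, fun s hs => ?_⟩ (Order.lt_add_one_iff.1 hlt)
      exact hb _ ((cons_mem_sprawlingIndexTree_add_one β).2 hs)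
  | limit η hη _ =>
    rcases hγ.eq_or_lt with rfl | hlt
    · exact h
    · obtain ⟨x, hx, hb⟩ := h
      obtain ⟨n, hn⟩ := β.surjective η hη hα ⟨γ, hlt⟩
      have hn' : (β.seq η hη n : Ordinal) = γ := by rw [hn]
      rw [← hn']
      exact ⟨_, ((isSprawlingTree_limit β hη).1 hx).2 n,
        fun s hs => hb _ ((zero_cons_mem_sprawlingIndexTree_limit β hη).2 hs)⟩

theorem lt_sprawlingIndexAt_iff {δ : ℝ} {α : Ordinal.{0}} (hα : α < ω_ 1) :
    (α : WithTop Ordinal.{0}) < sprawlingIndexAt β X δ ↔ BallContainsSprawlingTree β X δ α := by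
  constructor
  · intro h
    by_contra hn
    exact (h.trans_le (iInf₂_le α ⟨hα, hn⟩)).false
  · intro h
    refine lt_of_lt_of_le (b := ((α + 1 : Ordinal.{0}) : WithTop Ordinal.{0}))
      (WithTop.coe_lt_coe.2 (Order.lt_add_one_iff.2 le_rfl)) (le_iInf₂ fun γ hγ => ?_)
    rw [WithTop.coe_le_coe, Order.add_one_le_iff]
    by_contra! hle
    exact hγ.2 (h.mono β hα hle)

theorem lt_sprawlingIndex_iff {α : Ordinal.{0}} (hα : α < ω_ 1) :
    (α : WithTop Ordinal.{0}) < sprawlingIndex β X ↔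
      ∃ δ : ℝ, 0 < δ ∧ BallContainsSprawlingTree β X δ α := by
  simp only [sprawlingIndex, lt_iSup_iff, lt_sprawlingIndexAt_iff β hα, Set.mem_Ioi, exists_prop]

/-- The ball of a zero space contains no sprawling trees of positive rank. -/
theorem BallContainsSprawlingTree.exists_norm_eq_one {δ : ℝ} (hδ : 0 < δ) {α : Ordinal.{0}}
    (hα₀ : 0 < α) (hα : α < ω_ 1) (h : BallContainsSprawlingTree β X δ α) :
    ∃ u : X, ‖u‖ = 1 := by
  have h1 : BallContainsSprawlingTree β X δ (0 + 1) :=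
    h.mono β hα (by simpa using Order.one_le_iff_pos.2 hα₀)
  obtain ⟨x, hx, -⟩ := h1
  have hs := ((isSprawlingTree_add_one β).1 hx).2.1 0 1 zero_ne_one
  have hne : x [(0, 0)] - x [(0, 1)] ≠ 0 := norm_pos_iff.1 (hδ.trans_le hs)
  exact ⟨‖x [(0, 0)] - x [(0, 1)]‖⁻¹ • (x [(0, 0)] - x [(0, 1)]), norm_smul_inv_norm hne⟩

/-- A sprawling tree in the unit ball can be moved away from the origin. -/
theorem BallContainsSprawlingTree.exists_norm_ge {δ : ℝ} {α : Ordinal.{0}}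
    (h : BallContainsSprawlingTree β X δ α) {u : X} (hu : ‖u‖ = 1) :
    ∃ x : SprawlSeq → X, IsSprawlingTree β (δ / 3) α x ∧
      ∀ s ∈ sprawlingIndexTree β α, 1 / 3 ≤ ‖x s‖ ∧ ‖x s‖ ≤ 1 := by
  obtain ⟨x, hx, hb⟩ := h
  -- Translation preserves midpoints and differences. It places the norms in `[1, 3]`, and the
  -- factor 1/3 returns the tree to the unit ball.
  refine ⟨fun s => (1 / 3 : ℝ) • ((2 : ℝ) • u + x s), fun s hs => ⟨fun h0 h1 => ?_,
    fun h0 h1 n => by simp only [(hx s hs).2 h0 h1 n]⟩, fun s hs => ?_⟩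
  · obtain ⟨hm, hsep⟩ := (hx s hs).1 h0 h1
    refine ⟨fun n => ?_, fun n m hnm => ?_⟩
    · simp only [hm n]
      module
    · rw [← smul_sub, add_sub_add_left_eq_sub, norm_smul, Real.norm_of_nonneg (by norm_num)]
      linarith [hsep n m hnm]
  · have h2 : ‖(2 : ℝ) • u‖ = 2 := by rw [norm_smul, hu]; norm_num
    have hx1 : ‖x s‖ ≤ 1 := mem_closedBall_zero_iff.1 (hb s hs)
    have hlow := norm_sub_le_norm_add ((2 : ℝ) • u) (x s)
    have hup := norm_add_le ((2 : ℝ) • u) (x s)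
    simp only [norm_smul (1 / 3 : ℝ), Real.norm_of_nonneg (show (0 : ℝ) ≤ 1 / 3 by norm_num)]
    constructor <;> linarith

end Trees

/-! ### The metric of the diamond graphs -/

namespace Diamond

variable {D : Diamond}

theorem Walk.append {u v w : D.Vertex} {L M : ℝ} (p : D.Walk u v L) (q : D.Walk v w M) :
    D.Walk u w (L + M) := by
  induction p with
  | nil u => simpa using q
  | cons h _ ih =>
    rw [add_assoc]
    exact .cons h (ih q)

theorem Walk.of_edge {u v : D.Vertex} {ℓ : ℝ} (h : D.Edge s(u, v) ℓ) : D.Walk u v ℓ := by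
  simpa using Walk.cons h (.nil v)

theorem Walk.reverse {u v : D.Vertex} {L : ℝ} (p : D.Walk u v L) : D.Walk v u L := by
  induction p with
  | nil u => exact .nil u
  | cons h _ ih =>
    rw [add_comm]
    exact ih.append (.of_edge (by rwa [Sym2.eq_swap]))

theorem Walk.map {E : Diamond} (φ : D.Vertex → E.Vertex) (c : ℝ)
    (hφ : ∀ e ℓ, D.Edge e ℓ → E.Edge (e.map φ) (c * ℓ)) {u v : D.Vertex} {L : ℝ}
    (p : D.Walk u v L) : E.Walk (φ u) (φ v) (c * L) := by
  induction p with
  | nil u => simpa using Walk.nil (φ u)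
  | cons h _ ih =>
    rw [mul_add]
    exact .cons (by simpa using hφ _ _ h) ih

/-- The function `φ` is `1`-Lipschitz along the edges. -/
def EdgeLipschitz (D : Diamond) (φ : D.Vertex → ℝ) : Prop :=
  ∀ ⦃u v : D.Vertex⦄ ⦃ℓ : ℝ⦄, D.Edge s(u, v) ℓ → φ u - φ v ≤ ℓ

/-- Increments telescope along a walk. The distances below are bounded from below by choosing a
suitable test function `φ`. -/
theorem EdgeLipschitz.sub_le {φ : D.Vertex → ℝ} (hφ : D.EdgeLipschitz φ) {u v : D.Vertex} {L : ℝ}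
    (p : D.Walk u v L) : φ u - φ v ≤ L := by
  induction p with
  | nil u => simp
  | cons h _ ih => linarith [hφ h]

/-- A height function, decreasing from `1` at the top to `0` at the bottom. -/
structure IsHeight (D : Diamond) (h : D.Vertex → ℝ) : Prop where
  top : h .top = 1
  bot : h .bot = 0
  lip : D.EdgeLipschitz h

/-- The basic properties shared by all the diamond graphs `D_α`. -/
structure IsRegular (D : Diamond) : Prop where
  connected : ∀ u v : D.Vertex, ∃ L, D.Walk u v L
  walk_top_bot : D.Walk .top .bot 1
  exists_height : ∃ h, D.IsHeight h
  top_bot_active : s(.top, .bot) ∈ D.active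

theorem connected_of_walk_top (h : ∀ u : D.Vertex, ∃ L, D.Walk u .top L) (u v : D.Vertex) :
    ∃ L, D.Walk u v L :=
  let ⟨_, p⟩ := h u
  let ⟨_, q⟩ := h v
  ⟨_, p.append q.reverse⟩

namespace EdgeLipschitz

variable {φ : D.Vertex → ℝ}

theorem swap (hφ : D.EdgeLipschitz φ) ⦃u v : D.Vertex⦄ ⦃ℓ : ℝ⦄ (h : D.Edge s(u, v) ℓ) :
    φ v - φ u ≤ ℓ :=
  hφ (by rwa [Sym2.eq_swap])

theorem nonneg (hφ : D.EdgeLipschitz φ) ⦃u v : D.Vertex⦄ ⦃ℓ : ℝ⦄ (h : D.Edge s(u, v) ℓ) :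
    0 ≤ ℓ := by
  linarith [hφ h, hφ.swap h]

theorem const_add_mul (hφ : D.EdgeLipschitz φ) (a : ℝ) {b : ℝ} (hb : |b| ≤ 1) :
    D.EdgeLipschitz fun w => a + b * φ w := by
  intro u v ℓ h
  have h1 : |φ u - φ v| ≤ ℓ := abs_sub_le_iff.2 ⟨hφ h, hφ.swap h⟩
  calc a + b * φ u - (a + b * φ v) = b * (φ u - φ v) := by ring
    _ ≤ |b| * |φ u - φ v| := (le_abs_self _).trans (abs_mul _ _).le
    _ ≤ 1 * ℓ := mul_le_mul hb h1 (abs_nonneg _) zero_le_one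
    _ = ℓ := one_mul ℓ

theorem const (hφ : D.EdgeLipschitz φ) (a : ℝ) : D.EdgeLipschitz fun _ => a := by
  simpa using hφ.const_add_mul a (b := 0) (by simp)

end EdgeLipschitz

namespace IsRegular

/-- A height function read in both directions along an edge forces its length to be nonnegative.
This bounds below the set whose infimum is `dist`. -/
theorem walk_nonneg (hD : D.IsRegular) {u v : D.Vertex} {L : ℝ} (p : D.Walk u v L) : 0 ≤ L := by
  obtain ⟨h, hh⟩ := hD.exists_height
  simpa using (hh.lip.const 0).sub_le p

theorem dist_le (hD : D.IsRegular) {u v : D.Vertex} {L : ℝ} (p : D.Walk u v L) :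
    D.dist u v ≤ L :=
  csInf_le ⟨0, fun _ q => hD.walk_nonneg q⟩ p

theorem le_dist (hD : D.IsRegular) {u v : D.Vertex} {c : ℝ} (h : ∀ L, D.Walk u v L → c ≤ L) :
    c ≤ D.dist u v :=
  le_csInf (hD.connected u v) h

theorem sub_le_dist (hD : D.IsRegular) {φ : D.Vertex → ℝ} (hφ : D.EdgeLipschitz φ)
    (u v : D.Vertex) : φ u - φ v ≤ D.dist u v :=
  hD.le_dist fun _ p => hφ.sub_le p

theorem dist_comm (hD : D.IsRegular) (u v : D.Vertex) : D.dist u v = D.dist v u :=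
  le_antisymm (hD.le_dist fun _ p => hD.dist_le p.reverse)
    (hD.le_dist fun _ p => hD.dist_le p.reverse)

theorem dist_triangle (hD : D.IsRegular) (u v w : D.Vertex) :
    D.dist u w ≤ D.dist u v + D.dist v w := by
  rw [← sub_le_iff_le_add]
  refine hD.le_dist fun L p => ?_
  rw [sub_le_comm]
  refine hD.le_dist fun M q => ?_
  linarith [hD.dist_le (p.append q)]

theorem dist_self_le (hD : D.IsRegular) (u : D.Vertex) : D.dist u u ≤ 0 :=
  hD.dist_le (.nil u)

theorem dist_top_bot (hD : D.IsRegular) : D.dist .top .bot = 1 := by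
  obtain ⟨h, hh⟩ := hD.exists_height
  refine le_antisymm (hD.dist_le hD.walk_top_bot) ?_
  simpa [hh.top, hh.bot] using hD.sub_le_dist hh.lip .top .bot

theorem edgeLipschitz_dist (hD : D.IsRegular) (v : D.Vertex) :
    D.EdgeLipschitz fun w => D.dist w v := by
  intro u w ℓ h
  linarith [hD.dist_triangle u w v, hD.dist_le (.of_edge h)]

end IsRegular

theorem isHeight_zero :
    zero.IsHeight (fun w => match w with | .top => 1 | .bot => 0 | .inner _ => 0) := by
  refine ⟨rfl, rfl, ?_⟩
  rintro u v ℓ ⟨h, rfl⟩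
  rcases Sym2.eq_iff.1 h with ⟨rfl, rfl⟩ | ⟨rfl, rfl⟩ <;> norm_num

theorem isRegular_zero : zero.IsRegular where
  connected := connected_of_walk_top fun u => match u with
    | .top => ⟨_, .nil _⟩
    | .bot => ⟨1, .of_edge ⟨Sym2.eq_swap, rfl⟩⟩
    | .inner p => p.elim
  walk_top_bot := .of_edge ⟨rfl, rfl⟩
  exists_height := ⟨_, isHeight_zero⟩
  top_bot_active := rfl

/-! ### Successors -/

/-- The factor 2 compensates for the halved edge lengths in the copies. -/
theorem EdgeLipschitz.succ {φ : D.succ.Vertex → ℝ}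
    (hu : ∀ j, D.EdgeLipschitz fun w => 2 * φ (upperCopy j w))
    (hl : ∀ j, D.EdgeLipschitz fun w => 2 * φ (lowerCopy j w)) : D.succ.EdgeLipschitz φ := by
  rintro u v ℓ ⟨e, m, j, he, rfl, h⟩
  induction e with | _ a b =>
  have h1 := hu j he
  have h2 := (hu j).swap he
  have h3 := hl j he
  have h4 := (hl j).swap he
  rcases h with h | h <;> rcases Sym2.eq_iff.1 h with ⟨rfl, rfl⟩ | ⟨rfl, rfl⟩ <;> linarith

theorem Walk.upperCopy {u v : D.Vertex} {L : ℝ} (p : D.Walk u v L) (j : ℕ) :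
    D.succ.Walk (upperCopy j u) (upperCopy j v) (1 / 2 * L) :=
  p.map (E := D.succ) (Diamond.upperCopy j) _ fun e ℓ h => ⟨e, ℓ, j, h, by ring, .inl rfl⟩

theorem Walk.lowerCopy {u v : D.Vertex} {L : ℝ} (p : D.Walk u v L) (j : ℕ) :
    D.succ.Walk (lowerCopy j u) (lowerCopy j v) (1 / 2 * L) :=
  p.map (E := D.succ) (Diamond.lowerCopy j) _ fun e ℓ h => ⟨e, ℓ, j, h, by ring, .inr rfl⟩

/-- The function on `D_{α+1}` given by the functions `φ j` on the upper copies and `ψ j` on the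
lower copies. -/
def glue (φ ψ : ℕ → D.Vertex → ℝ) : D.succ.Vertex → ℝ
  -- The index 0 is arbitrary: the top and the bottom belong to every copy, and `glue` is only used
  -- when the pieces agree there.
  | .top => φ 0 .top
  | .bot => ψ 0 .bot
  | .inner (.mid j) => φ j .bot
  | .inner (.upper j p) => φ j (.inner p)
  | .inner (.lower j p) => ψ j (.inner p)

section glue

variable {φ ψ : ℕ → D.Vertex → ℝ}

theorem glue_upperCopy (ht : ∀ j, φ j .top = φ 0 .top) (j : ℕ) (w : D.Vertex) :
    glue φ ψ (upperCopy j w) = φ j w := by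
  cases w <;> simp [upperCopy, glue, ht]

theorem glue_lowerCopy (hb : ∀ j, ψ j .bot = ψ 0 .bot) (hm : ∀ j, φ j .bot = ψ j .top)
    (j : ℕ) (w : D.Vertex) : glue φ ψ (lowerCopy j w) = ψ j w := by
  cases w <;> simp [lowerCopy, glue, hb, hm]

theorem EdgeLipschitz.glue (ht : ∀ j, φ j .top = φ 0 .top) (hb : ∀ j, ψ j .bot = ψ 0 .bot)
    (hm : ∀ j, φ j .bot = ψ j .top) (hφ : ∀ j, D.EdgeLipschitz fun w => 2 * φ j w)
    (hψ : ∀ j, D.EdgeLipschitz fun w => 2 * ψ j w) :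
    D.succ.EdgeLipschitz (Diamond.glue φ ψ) :=
  .succ (by simpa only [glue_upperCopy ht] using hφ) (by simpa only [glue_lowerCopy hb hm] using hψ)

end glue

namespace IsRegular

theorem succ (hD : D.IsRegular) : D.succ.IsRegular where
  connected := connected_of_walk_top fun u => by
    have hmid (j : ℕ) : D.succ.Walk (.inner (.mid j)) .top (1 / 2 * 1) :=
      hD.walk_top_bot.reverse.upperCopy j
    match u with
    | .top => exact ⟨_, .nil _⟩
    | .bot => exact ⟨_, .append (hD.walk_top_bot.reverse.lowerCopy 0) (hmid 0)⟩
    | .inner (.mid j) => exact ⟨_, hmid j⟩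
    | .inner (.upper j p) =>
      obtain ⟨L, q⟩ := hD.connected (.inner p) .top
      exact ⟨_, q.upperCopy j⟩
    | .inner (.lower j p) =>
      obtain ⟨L, q⟩ := hD.connected (.inner p) .top
      exact ⟨_, (q.lowerCopy j).append (hmid j)⟩
  walk_top_bot := by
    have := (hD.walk_top_bot.upperCopy 0).append (hD.walk_top_bot.lowerCopy 0)
    norm_num at this
    exact this
  exists_height := by
    obtain ⟨h, hh⟩ := hD.exists_height
    refine ⟨glue (fun _ w => 1 / 2 + 1 / 2 * h w) (fun _ w => 1 / 2 * h w), ?_, ?_,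
      .glue ?_ ?_ ?_ ?_ ?_⟩
    · simp only [glue, hh.top]; norm_num
    · simp only [glue, hh.bot]; norm_num
    · simp
    · simp
    · simp [hh.top, hh.bot]
    · intro j u v ℓ he
      linarith [hh.lip he]
    · intro j u v ℓ he
      linarith [hh.lip he]
  top_bot_active :=
    .inl ⟨.top, by simp [originalVertices], .bot, by simp [originalVertices], by simp, rfl⟩

/-- Detours outside the copy do not shorten paths. The test function is `d(·, v) / 2` on every upper
copy, continued by its value at the middle vertices as a constant on the lower copies. -/
theorem dist_upperCopy (hD : D.IsRegular) (j : ℕ) (u v : D.Vertex) :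
    D.succ.dist (upperCopy j u) (upperCopy j v) = 1 / 2 * D.dist u v := by
  apply le_antisymm
  · suffices 2 * D.succ.dist (upperCopy j u) (upperCopy j v) ≤ D.dist u v by linarith
    exact hD.le_dist fun L p => by linarith [hD.succ.dist_le (p.upperCopy j)]
  · have hlip : D.succ.EdgeLipschitz (glue (fun _ w => 1 / 2 * D.dist w v)
        (fun _ _ => 1 / 2 * D.dist .bot v)) := by
      refine .glue (fun _ => rfl) (fun _ => rfl) (fun _ => rfl) (fun i a b ℓ he => ?_)
        (fun i a b ℓ he => ?_)
      · linarith [hD.edgeLipschitz_dist v he]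
      · linarith [(hD.edgeLipschitz_dist v).nonneg he]
    have := hD.succ.sub_le_dist hlip (upperCopy j u) (upperCopy j v)
    rw [glue_upperCopy (fun _ => rfl), glue_upperCopy (fun _ => rfl)] at this
    linarith [hD.dist_self_le v]

theorem dist_lowerCopy (hD : D.IsRegular) (j : ℕ) (u v : D.Vertex) :
    D.succ.dist (lowerCopy j u) (lowerCopy j v) = 1 / 2 * D.dist u v := by
  apply le_antisymm
  · suffices 2 * D.succ.dist (lowerCopy j u) (lowerCopy j v) ≤ D.dist u v by linarith
    exact hD.le_dist fun L p => by linarith [hD.succ.dist_le (p.lowerCopy j)]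
  · have hlip : D.succ.EdgeLipschitz (glue (fun _ _ => 1 / 2 * D.dist .top v)
        (fun _ w => 1 / 2 * D.dist w v)) := by
      refine .glue (fun _ => rfl) (fun _ => rfl) (fun _ => rfl) (fun i a b ℓ he => ?_)
        (fun i a b ℓ he => ?_)
      · linarith [(hD.edgeLipschitz_dist v).nonneg he]
      · linarith [hD.edgeLipschitz_dist v he]
    have := hD.succ.sub_le_dist hlip (lowerCopy j u) (lowerCopy j v)
    rw [glue_lowerCopy (fun _ => rfl) (fun _ => rfl), glue_lowerCopy (fun _ => rfl) (fun _ => rfl)]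
      at this
    linarith [hD.dist_self_le v]

theorem dist_top_mid (hD : D.IsRegular) (j : ℕ) :
    D.succ.dist .top (.inner (.mid j)) = 1 / 2 := by
  have := hD.dist_upperCopy j .top .bot
  rwa [hD.dist_top_bot, mul_one] at this

theorem dist_mid_mid (hD : D.IsRegular) {i j : ℕ} (hij : i ≠ j) :
    D.succ.dist (.inner (.mid i)) (.inner (.mid j)) = 1 := by
  apply le_antisymm
  · have := hD.succ.dist_triangle (.inner (.mid i)) .top (.inner (.mid j))
    rw [hD.succ.dist_comm _ .top, hD.dist_top_mid, hD.dist_top_mid] at this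
    linarith
  · obtain ⟨h, hh⟩ := hD.exists_height
    -- The test function is 1/2 at the top and bottom, rises to 1 at `x^i` and falls to 0 at all
    -- other middle vertices.
    have hlip : D.succ.EdgeLipschitz (glue
        (fun k w => 1 / 2 + (if k = i then 1 / 2 else -(1 / 2)) * (1 - h w))
        (fun k w => 1 / 2 + (if k = i then 1 / 2 else -(1 / 2)) * h w)) := by
      refine .glue (fun _ => ?_) (fun _ => ?_) (fun _ => ?_) (fun k a b ℓ he => ?_)
        (fun k a b ℓ he => ?_)
      · simp [hh.top]
      · simp [hh.bot]
      · simp [hh.top, hh.bot]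
      · have := hh.lip he
        have := hh.lip.swap he
        dsimp only
        split_ifs <;> linarith
      · have := hh.lip he
        have := hh.lip.swap he
        dsimp only
        split_ifs <;> linarith
    have := hD.succ.sub_le_dist hlip (.inner (.mid i)) (.inner (.mid j))
    simp only [glue, hh.bot, if_true, if_neg hij.symm] at this
    linarith

end IsRegular

/-! ### Unions -/

section union

variable {D : ℕ → Diamond}

theorem EdgeLipschitz.union {φ : (union D).Vertex → ℝ}
    (h : ∀ n, (D n).EdgeLipschitz fun w => φ (pieceIncl (I := fun n => (D n).Inner) n w)) :
    (Diamond.union D).EdgeLipschitz φ := by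
  rintro u v ℓ ⟨n, e, he, h'⟩
  induction e with | _ a b =>
  rcases Sym2.eq_iff.1 h' with ⟨rfl, rfl⟩ | ⟨rfl, rfl⟩
  · exact h n he
  · exact (h n).swap he

theorem Walk.pieceIncl {n : ℕ} {u v : (D n).Vertex} {L : ℝ} (p : (D n).Walk u v L) :
    (union D).Walk (pieceIncl (I := fun n => (D n).Inner) n u)
      (pieceIncl (I := fun n => (D n).Inner) n v) L := by
  simpa using p.map (E := Diamond.union D)
    (Diamond.pieceIncl (I := fun n => (D n).Inner) n) 1
    fun e ℓ h => ⟨n, e, by simpa using h, rfl⟩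

/-- The function on the union of a sequence of diamonds given by functions on the pieces. -/
def glueUnion (φ : ∀ n, (D n).Vertex → ℝ) : (union D).Vertex → ℝ
  | .top => φ 0 .top
  | .bot => φ 0 .bot
  | .inner ⟨n, p⟩ => φ n (.inner p)

variable {φ : ∀ n, (D n).Vertex → ℝ}

theorem glueUnion_pieceIncl (ht : ∀ n, φ n .top = φ 0 .top) (hb : ∀ n, φ n .bot = φ 0 .bot)
    (n : ℕ) (w : (D n).Vertex) :
    glueUnion φ (pieceIncl (I := fun n => (D n).Inner) n w) = φ n w := by
  cases w <;> simp [pieceIncl, glueUnion, ht, hb]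

theorem EdgeLipschitz.glueUnion (ht : ∀ n, φ n .top = φ 0 .top) (hb : ∀ n, φ n .bot = φ 0 .bot)
    (hφ : ∀ n, (D n).EdgeLipschitz (φ n)) :
    (Diamond.union D).EdgeLipschitz (Diamond.glueUnion φ) :=
  .union (by simpa only [glueUnion_pieceIncl ht hb] using hφ)

theorem isRegular_union (hD : ∀ n, (D n).IsRegular) : (union D).IsRegular where
  connected := connected_of_walk_top fun u => match u with
    | .top => ⟨_, .nil _⟩
    | .bot => ⟨_, (hD 0).walk_top_bot.reverse.pieceIncl⟩
    | .inner ⟨n, p⟩ =>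
      let ⟨_, q⟩ := (hD n).connected (.inner p) .top
      ⟨_, q.pieceIncl⟩
  walk_top_bot := (hD 0).walk_top_bot.pieceIncl
  exists_height := by
    choose h hh using fun n => (hD n).exists_height
    exact ⟨glueUnion h, (hh 0).top, (hh 0).bot,
      .glueUnion (by simp [(hh _).top]) (by simp [(hh _).bot]) fun n => (hh n).lip⟩
  top_bot_active := Set.mem_iUnion.2 ⟨0, _, (hD 0).top_bot_active, rfl⟩

/-- For the lower bound, `d(·, v)` is extended from piece `n` to each other piece as an affine
function of the height with the same values at top and bottom. The slope is at most 1 because top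
and bottom are at distance 1. -/
theorem dist_pieceIncl (hD : ∀ n, (D n).IsRegular) (n : ℕ) (u v : (D n).Vertex) :
    (union D).dist (pieceIncl (I := fun n => (D n).Inner) n u)
      (pieceIncl (I := fun n => (D n).Inner) n v) = (D n).dist u v := by
  have hU := isRegular_union hD
  apply le_antisymm
  · exact (hD n).le_dist fun L p => hU.dist_le p.pieceIncl
  · choose h hh using fun n => (hD n).exists_height
    set a := (D n).dist .bot v
    set b := (D n).dist .top v
    have hab : |b - a| ≤ 1 := by
      have h1 := (hD n).dist_triangle .top .bot v
      have h2 := (hD n).dist_triangle .bot .top v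
      rw [(hD n).dist_top_bot] at h1
      rw [(hD n).dist_comm .bot .top, (hD n).dist_top_bot] at h2
      exact abs_sub_le_iff.2 ⟨by linarith, by linarith⟩
    -- The vertex type depends on `m`, so the case `m = n` is a transport along the equality.
    set φ : ∀ m, (D m).Vertex → ℝ := fun m => if hm : n = m then
      hm ▸ fun w => (D n).dist w v else fun w => a + (b - a) * h m w with hφ
    have hn : φ n = fun w => (D n).dist w v := by simp [hφ]
    have hm (m : ℕ) (hm : n ≠ m) : φ m = fun w => a + (b - a) * h m w := by simp [hφ, hm]
    have ht (m : ℕ) : φ m .top = b := by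
      by_cases hnm : n = m
      · subst hnm; rw [hn]
      · rw [hm m hnm]; simp [(hh m).top]
    have hb (m : ℕ) : φ m .bot = a := by
      by_cases hnm : n = m
      · subst hnm; rw [hn]
      · rw [hm m hnm]; simp [(hh m).bot]
    have hlip : (union D).EdgeLipschitz (glueUnion φ) := by
      refine .glueUnion (by simp [ht]) (by simp [hb]) fun m => ?_
      by_cases hnm : n = m
      · subst hnm; rw [hn]; exact (hD n).edgeLipschitz_dist v
      · rw [hm m hnm]; exact (hh m).lip.const_add_mul a hab
    have := hU.sub_le_dist hlip (pieceIncl (I := fun n => (D n).Inner) n u)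
      (pieceIncl (I := fun n => (D n).Inner) n v)
    rw [glueUnion_pieceIncl (by simp [ht]) (by simp [hb]),
      glueUnion_pieceIncl (by simp [ht]) (by simp [hb]), hn] at this
    linarith [(hD n).dist_self_le v]

end union

end Diamond

/-! ### Regularity of the graphs `D_α^ω` -/

section omegaDiamond

variable (β : LimitEnumeration)

theorem omegaDiamond_zero : omegaDiamond β 0 = Diamond.zero := by
  simp [omegaDiamond]

theorem omegaDiamond_add_one (γ : Ordinal.{0}) :
    omegaDiamond β (γ + 1) = (omegaDiamond β γ).succ := by
  simp only [omegaDiamond, limitRecOn_add_one]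

theorem omegaDiamond_limit (γ : Ordinal.{0}) (hγ : Order.IsSuccLimit γ) :
    omegaDiamond β γ = Diamond.union fun n => omegaDiamond β (β.seq γ hγ n) := by
  simp only [omegaDiamond, limitRecOn_limit (h := hγ)]

theorem isRegular_omegaDiamond (α : Ordinal.{0}) : (omegaDiamond β α).IsRegular := by
  induction α using Ordinal.limitRecOn with
  | zero =>
    rw [omegaDiamond_zero]
    exact Diamond.isRegular_zero
  | add_one γ ih =>
    rw [omegaDiamond_add_one]
    exact ih.succ
  | limit γ hγ ih =>
    rw [omegaDiamond_limit β γ hγ]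
    exact Diamond.isRegular_union fun n => ih _ (β.seq γ hγ n).2

end omegaDiamond

/-! ### Diamonds and sprawling trees -/

section DiamondsAndTrees

variable {X : Type*} [NormedAddCommGroup X]

/-- The function `f` on the vertices of `D` is bi-Lipschitz on active pairs, with constants `A`
and `B`. -/
def Diamond.SubLipschitzWith (D : Diamond) (A B : ℝ) (f : D.Vertex → X) : Prop :=
  ∀ u v : D.Vertex, s(u, v) ∈ D.active →
    A * D.dist u v ≤ ‖f u - f v‖ ∧ ‖f u - f v‖ ≤ B * D.dist u v

namespace Diamond.SubLipschitzWith

variable {A B : ℝ}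

theorem comp_pieceIncl {D : ℕ → Diamond} (hD : ∀ n, (D n).IsRegular)
    {f : (Diamond.union D).Vertex → X} (hf : (Diamond.union D).SubLipschitzWith A B f) (n : ℕ) :
    (D n).SubLipschitzWith A B fun w => f (pieceIncl (I := fun n => (D n).Inner) n w) := by
  intro u v huv
  have := hf _ _ (Set.mem_iUnion.2 ⟨n, _, huv, rfl⟩ :
    s(pieceIncl (I := fun n => (D n).Inner) n u, pieceIncl (I := fun n => (D n).Inner) n v) ∈
      (Diamond.union D).active)
  rwa [dist_pieceIncl hD] at this

theorem norm_top_sub_bot_le {D : Diamond} (hD : D.IsRegular) {f : D.Vertex → X}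
    (hf : D.SubLipschitzWith A B f) : ‖f .top - f .bot‖ ≤ B := by
  simpa [hD.dist_top_bot] using (hf _ _ hD.top_bot_active).2

theorem le_norm_mid_sub_mid {D : Diamond} (hD : D.IsRegular) {f : D.succ.Vertex → X}
    (hf : D.succ.SubLipschitzWith A B f) {i j : ℕ} (hij : i ≠ j) :
    A ≤ ‖f (.inner (.mid i)) - f (.inner (.mid j))‖ := by
  have := (hf (.inner (.mid i)) (.inner (.mid j)) (.inl ⟨_, .inr ⟨i, rfl⟩, _, .inr ⟨j, rfl⟩,
    by simpa using hij, rfl⟩)).1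
  rwa [hD.dist_mid_mid hij, mul_one] at this

theorem swap {D : Diamond} (hD : D.IsRegular) {f : D.Vertex → X} {u v : D.Vertex}
    (h : A * D.dist u v ≤ ‖f u - f v‖ ∧ ‖f u - f v‖ ≤ B * D.dist u v) :
    A * D.dist v u ≤ ‖f v - f u‖ ∧ ‖f v - f u‖ ≤ B * D.dist v u := by
  rwa [hD.dist_comm, norm_sub_rev]

theorem union {D : ℕ → Diamond} (hD : ∀ n, (D n).IsRegular)
    {f : (Diamond.union D).Vertex → X}
    (hf : ∀ n, (D n).SubLipschitzWith A B
      fun w => f (pieceIncl (I := fun n => (D n).Inner) n w)) :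
    (Diamond.union D).SubLipschitzWith A B f := by
  intro u v huv
  obtain ⟨n, e, he, h⟩ := Set.mem_iUnion.1 huv
  induction e with | _ a b =>
  have := hf n a b he
  rw [← dist_pieceIncl hD] at this
  rcases Sym2.eq_iff.1 h with ⟨rfl, rfl⟩ | ⟨rfl, rfl⟩
  · exact this
  · exact swap (isRegular_union hD) this

variable [NormedSpace ℝ X]

/-- Doubling cancels the scaling of the copy, so the induction keeps the same `A` and `B`. -/
theorem two_smul_upperCopy {D : Diamond} (hD : D.IsRegular) {f : D.succ.Vertex → X}
    (hf : D.succ.SubLipschitzWith A B f) (j : ℕ) :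
    D.SubLipschitzWith A B fun w => (2 : ℝ) • f (upperCopy j w) := by
  intro u v huv
  have := hf (upperCopy j u) (upperCopy j v) (.inr (Set.mem_iUnion.2 ⟨j, .inl ⟨_, huv, rfl⟩⟩))
  rw [hD.dist_upperCopy] at this
  rw [← smul_sub, norm_smul, Real.norm_ofNat]
  constructor <;> linarith

theorem two_smul_lowerCopy {D : Diamond} (hD : D.IsRegular) {f : D.succ.Vertex → X}
    (hf : D.succ.SubLipschitzWith A B f) (j : ℕ) :
    D.SubLipschitzWith A B fun w => (2 : ℝ) • f (lowerCopy j w) := by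
  intro u v huv
  have := hf (lowerCopy j u) (lowerCopy j v) (.inr (Set.mem_iUnion.2 ⟨j, .inr ⟨_, huv, rfl⟩⟩))
  rw [hD.dist_lowerCopy] at this
  rw [← smul_sub, norm_smul, Real.norm_ofNat]
  constructor <;> linarith

end Diamond.SubLipschitzWith

variable [NormedSpace ℝ X] (β : LimitEnumeration)

/-- The differences between the images of tops and bottoms of the copies of diamonds form a
sprawling tree. -/
theorem exists_sprawlingTree_of_subLipschitzWith {A B : ℝ} (α : Ordinal.{0})
    (f : (omegaDiamond β α).Vertex → X) (hf : (omegaDiamond β α).SubLipschitzWith A B f) :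
    ∃ x : SprawlSeq → X, IsSprawlingTree β (2 * A) α x ∧
      (∀ s ∈ sprawlingIndexTree β α, ‖x s‖ ≤ B) ∧ x [] = f .top - f .bot := by
  have hroot (α : Ordinal.{0}) {f : (omegaDiamond β α).Vertex → X}
      (hf : (omegaDiamond β α).SubLipschitzWith A B f) : ‖f .top - f .bot‖ ≤ B :=
    hf.norm_top_sub_bot_le (isRegular_omegaDiamond β α)
  have hnorm := hroot α hf
  induction α using Ordinal.limitRecOn with
  | zero =>
    exact ⟨fun _ => f .top - f .bot, isSprawlingTree_zero β _ _, fun _ _ => hnorm, rfl⟩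
  | add_one γ ih =>
    have hD := isRegular_omegaDiamond β γ
    revert f
    rw [omegaDiamond_add_one]
    intro f hf hnorm
    have hu (n : ℕ) := ih _ (hf.two_smul_upperCopy hD n)
      (hroot γ (hf.two_smul_upperCopy hD n))
    have hl (n : ℕ) := ih _ (hf.two_smul_lowerCopy hD n)
      (hroot γ (hf.two_smul_lowerCopy hD n))
    choose xu hxu hbu hru using hu
    choose xl hxl hbl hrl using hl
    have hru (n : ℕ) : xu n [] = (2 : ℝ) • f .top - (2 : ℝ) • f (.inner (.mid n)) := hru n
    have hrl (n : ℕ) : xl n [] = (2 : ℝ) • f (.inner (.mid n)) - (2 : ℝ) • f .bot := hrl n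
    refine ⟨fun s => match s with
      | [] => f .top - f .bot
      | (i, n) :: s => if i = 0 then xu n s else xl n s, ?_, ?_, rfl⟩
    · refine (isSprawlingTree_add_one β).2 ⟨fun n => ?_, fun n m hnm => ?_, fun i n => ?_⟩
      · simp only [if_true, one_ne_zero, if_false, hru, hrl]
        module
      -- The common top cancels: the difference of two siblings is `2 (f x^m - f x^n)`, hence the
      -- separation `2 * A`.
      · have := hf.le_norm_mid_sub_mid hD hnm.symm
        simp only [if_true, hru]
        rw [sub_sub_sub_cancel_left, ← smul_sub, norm_smul, Real.norm_ofNat]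
        linarith
      · obtain rfl | rfl : i = 0 ∨ i = 1 := by omega
        · exact hxu n
        · exact hxl n
    · rintro (_ | ⟨⟨i, n⟩, s⟩) hs
      · exact hnorm
      · rw [cons_mem_sprawlingIndexTree_add_one] at hs
        obtain rfl | rfl : i = 0 ∨ i = 1 := by omega
        · exact hbu n s hs
        · exact hbl n s hs
  | limit γ hγ ih =>
    have hD := fun n => isRegular_omegaDiamond β (β.seq γ hγ n)
    revert f
    rw [omegaDiamond_limit β γ hγ]
    intro f hf hnorm
    have h (n : ℕ) := ih _ (β.seq γ hγ n).2 _ (hf.comp_pieceIncl hD n)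
      (hroot _ (hf.comp_pieceIncl hD n))
    choose x hx hb hr using h
    refine ⟨fun s => match s with
      | [] => f .top - f .bot
      | (_, n) :: s => x n s, ?_, ?_, rfl⟩
    · exact (isSprawlingTree_limit β hγ).2 ⟨fun n => (hr n).symm, hx⟩
    · rintro (_ | ⟨⟨i, n⟩, s⟩) hs
      · exact hnorm
      · obtain rfl | rfl : i = 0 ∨ i = 1 := by omega
        · exact hb n s ((zero_cons_mem_sprawlingIndexTree_limit β hγ).1 hs)
        · exact absurd hs (one_cons_notMem_sprawlingIndexTree_limit β hγ)

namespace Diamond.SubLipschitzWith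

variable {A B : ℝ} {D : Diamond}

/-- On a copy both the distances and the norms are halved and the translation by `p` cancels, so the
constants are unchanged. -/
theorem of_add_half_smul {E : Diamond} {g : D.Vertex → X}
    (hg : D.SubLipschitzWith A B g) {φ : D.Vertex → E.Vertex} {f : E.Vertex → X} {p : X}
    (hf : ∀ w, f (φ w) = p + (1 / 2 : ℝ) • g w)
    (hφ : ∀ u v, E.dist (φ u) (φ v) = 1 / 2 * D.dist u v) {e : Sym2 D.Vertex}
    (he : e ∈ D.active) (hE : E.IsRegular) {u v : E.Vertex} (huv : e.map φ = s(u, v)) :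
    A * E.dist u v ≤ ‖f u - f v‖ ∧ ‖f u - f v‖ ≤ B * E.dist u v := by
  induction e with | _ a b =>
  have key : A * E.dist (φ a) (φ b) ≤ ‖f (φ a) - f (φ b)‖ ∧
      ‖f (φ a) - f (φ b)‖ ≤ B * E.dist (φ a) (φ b) := by
    have := hg a b he
    rw [hφ, hf, hf, add_sub_add_left_eq_sub, ← smul_sub, norm_smul,
      Real.norm_of_nonneg (by norm_num)]
    constructor <;> linarith
  rcases Sym2.eq_iff.1 huv with ⟨rfl, rfl⟩ | ⟨rfl, rfl⟩
  · exact key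
  · exact swap hE key

/-- Maps on the copies of `D_α` and on the original vertices glue to a map on `D_{α+1}`. -/
theorem succ (hD : D.IsRegular) {f : D.succ.Vertex → X} {gu gl : ℕ → D.Vertex → X} {pu pl : ℕ → X}
    (hgu : ∀ j, D.SubLipschitzWith A B (gu j)) (hgl : ∀ j, D.SubLipschitzWith A B (gl j))
    (hfu : ∀ j w, f (upperCopy j w) = pu j + (1 / 2 : ℝ) • gu j w)
    (hfl : ∀ j w, f (lowerCopy j w) = pl j + (1 / 2 : ℝ) • gl j w)
    (htb : A ≤ ‖f .top - f .bot‖ ∧ ‖f .top - f .bot‖ ≤ B)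
    (hmm : ∀ i j, i ≠ j → A ≤ ‖f (.inner (.mid i)) - f (.inner (.mid j))‖ ∧
      ‖f (.inner (.mid i)) - f (.inner (.mid j))‖ ≤ B) :
    D.succ.SubLipschitzWith A B f := by
  have htop_bot : A * D.succ.dist .top .bot ≤ ‖f .top - f .bot‖ ∧
      ‖f .top - f .bot‖ ≤ B * D.succ.dist .top .bot := by
    simpa [hD.succ.dist_top_bot] using htb
  -- The edges of the original `D_1` are the top-bottom pairs of the copies, so they need no
  -- separate hypothesis.
  have htop_mid (j : ℕ) : A * D.succ.dist .top (.inner (.mid j)) ≤ ‖f .top - f (.inner (.mid j))‖ ∧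
      ‖f .top - f (.inner (.mid j))‖ ≤ B * D.succ.dist .top (.inner (.mid j)) :=
    of_add_half_smul (hgu j) (hfu j) (hD.dist_upperCopy j) hD.top_bot_active hD.succ rfl
  have hmid_bot (j : ℕ) : A * D.succ.dist (.inner (.mid j)) .bot ≤ ‖f (.inner (.mid j)) - f .bot‖ ∧
      ‖f (.inner (.mid j)) - f .bot‖ ≤ B * D.succ.dist (.inner (.mid j)) .bot :=
    of_add_half_smul (hgl j) (hfl j) (hD.dist_lowerCopy j) hD.top_bot_active hD.succ rfl
  have horig (u v : D.succ.Vertex) (hu : u ∈ originalVertices D.Inner)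
      (hv : v ∈ originalVertices D.Inner) (huv : u ≠ v) :
      A * D.succ.dist u v ≤ ‖f u - f v‖ ∧ ‖f u - f v‖ ≤ B * D.succ.dist u v := by
    rcases hu with (rfl | rfl) | ⟨i, rfl⟩ <;> rcases hv with (rfl | rfl) | ⟨j, rfl⟩
    · exact absurd rfl huv
    · exact htop_bot
    · exact htop_mid j
    · exact swap hD.succ htop_bot
    · exact absurd rfl huv
    · exact swap hD.succ (hmid_bot j)
    · exact swap hD.succ (htop_mid i)
    · exact hmid_bot i
    · have hij : i ≠ j := fun h => huv (by rw [h])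
      have key := hmm i j hij
      rw [← mul_one A, ← mul_one B, ← hD.dist_mid_mid hij] at key
      exact key
  rintro u v (⟨a, ha, b, hb, hab, huv⟩ | huv)
  · rcases Sym2.eq_iff.1 huv with ⟨rfl, rfl⟩ | ⟨rfl, rfl⟩
    · exact horig _ _ ha hb hab
    · exact horig _ _ hb ha hab.symm
  · obtain ⟨j, ⟨e, he, h⟩ | ⟨e, he, h⟩⟩ := Set.mem_iUnion.1 huv
    · exact of_add_half_smul (hgu j) (hfu j) (hD.dist_upperCopy j) he hD.succ h
    · exact of_add_half_smul (hgl j) (hfl j) (hD.dist_lowerCopy j) he hD.succ h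

end Diamond.SubLipschitzWith

/-- A sprawling tree which is bounded and bounded away from the origin yields a sub-Lipschitz
embedding of the diamond. -/
theorem exists_subLipschitzWith_of_sprawlingTree {δ A B : ℝ} (hδ : 2 * A ≤ δ) (α : Ordinal.{0})
    (x : SprawlSeq → X) (hx : IsSprawlingTree β δ α x)
    (hb : ∀ s ∈ sprawlingIndexTree β α, A ≤ ‖x s‖ ∧ ‖x s‖ ≤ B) :
    ∃ f : (omegaDiamond β α).Vertex → X, (omegaDiamond β α).SubLipschitzWith A B f ∧
      f .top = x [] ∧ f .bot = 0 := by
  induction α using Ordinal.limitRecOn generalizing x with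
  | zero =>
    have hroot := hb [] (nil_mem_sprawlingIndexTree β _)
    rw [omegaDiamond_zero]
    have htb : A * Diamond.zero.dist .top .bot ≤ ‖x [] - 0‖ ∧
        ‖x [] - 0‖ ≤ B * Diamond.zero.dist .top .bot := by
      simpa [Diamond.isRegular_zero.dist_top_bot] using hroot
    refine ⟨fun w => match w with | .top => x [] | .bot => 0 | .inner _ => 0, ?_, rfl, rfl⟩
    intro u v huv
    rcases Sym2.eq_iff.1 (Set.mem_singleton_iff.1 huv) with ⟨rfl, rfl⟩ | ⟨rfl, rfl⟩
    · exact htb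
    · exact Diamond.SubLipschitzWith.swap (f := fun w : Diamond.zero.Vertex => match w with
        | .top => x [] | .bot => 0 | .inner _ => 0) Diamond.isRegular_zero htb
  | add_one γ ih =>
    have hD := isRegular_omegaDiamond β γ
    obtain ⟨hmid, hsep, hsub⟩ := (isSprawlingTree_add_one β).1 hx
    have hroot := hb [] (nil_mem_sprawlingIndexTree β _)
    have h (i : Fin 2) (n : ℕ) := ih _ (hsub i n)
      fun s hs => hb _ ((cons_mem_sprawlingIndexTree_add_one β).2 hs)
    choose g hg ht hbot using h
    have hone (n : ℕ) : x [(1, n)] = (2 : ℝ) • x [] - x [(0, n)] := by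
      rw [hmid n]
      module
    have hle (i : Fin 2) (n : ℕ) : ‖x [(i, n)]‖ ≤ B :=
      (hb _ ((cons_mem_sprawlingIndexTree_add_one β).2 (nil_mem_sprawlingIndexTree β _))).2
    rw [omegaDiamond_add_one]
    -- The lower copy rises from 0 by `x_{(1,n)} / 2` to `x^n`, and the upper copy from there by
    -- `x_{(0,n)} / 2`. The midpoint identity makes all upper copies end at `x_∅`.
    refine ⟨fun w => match w with
      | .top => x []
      | .bot => 0
      | .inner (.mid n) => (1 / 2 : ℝ) • x [(1, n)]
      | .inner (.upper n p) => (1 / 2 : ℝ) • x [(1, n)] + (1 / 2 : ℝ) • g 0 n (.inner p)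
      | .inner (.lower n p) => (1 / 2 : ℝ) • g 1 n (.inner p), ?_, rfl, rfl⟩
    refine .succ hD (hg 0) (hg 1) (pu := fun n => (1 / 2 : ℝ) • x [(1, n)]) (pl := fun _ => 0)
      (fun n w => ?_) (fun n w => ?_) ?_ fun n m hnm => ?_
    · cases w with
      | top =>
        simp only [Diamond.upperCopy, ht]
        rw [hmid n]
        module
      | bot => simp [Diamond.upperCopy, hbot]
      | inner p => rfl
    · cases w with
      | top => simp [Diamond.lowerCopy, ht]
      | bot => simp [Diamond.lowerCopy, hbot]
      | inner p => simp [Diamond.lowerCopy]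
    · simpa using hroot
    · dsimp only
      have h1 := hsep m n hnm.symm
      have h2 : ‖x [(1, n)] - x [(1, m)]‖ ≤ B + B := (norm_sub_le _ _).trans
        (add_le_add (hle 1 n) (hle 1 m))
      -- The common midpoint transfers the separation from the 0-successors to the 1-successors,
      -- which carry the middle vertices.
      have h3 : x [(1, n)] - x [(1, m)] = x [(0, m)] - x [(0, n)] := by
        rw [hone, hone, sub_sub_sub_cancel_left]
      rw [← smul_sub, norm_smul, Real.norm_of_nonneg (by norm_num)]
      rw [← h3] at h1
      constructor <;> linarith
  | limit γ hγ ih =>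
    have hD := fun n => isRegular_omegaDiamond β (β.seq γ hγ n)
    obtain ⟨hroot, hsub⟩ := (isSprawlingTree_limit β hγ).1 hx
    have h (n : ℕ) := ih _ (β.seq γ hγ n).2 _ (hsub n)
      fun s hs => hb _ ((zero_cons_mem_sprawlingIndexTree_limit β hγ).2 hs)
    choose g hg ht hbot using h
    rw [omegaDiamond_limit β γ hγ]
    refine ⟨fun w => match w with
      | .top => x []
      | .bot => 0
      | .inner ⟨n, p⟩ => g n (.inner p), .union hD fun n => ?_, rfl, rfl⟩
    convert hg n using 2 with w
    cases w with
    | top => simp [Diamond.pieceIncl, ht, hroot n]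
    | bot => simp [Diamond.pieceIncl, hbot]
    | inner p => rfl

/-- Dividing a bounded sprawling tree by its bound puts it into the unit ball. -/
theorem BallContainsSprawlingTree.of_bound {δ B : ℝ} (hB : 0 < B) {α : Ordinal.{0}}
    {x : SprawlSeq → X} (hx : IsSprawlingTree β δ α x)
    (hb : ∀ s ∈ sprawlingIndexTree β α, ‖x s‖ ≤ B) :
    BallContainsSprawlingTree β X (δ / B) α := by
  refine ⟨fun s => B⁻¹ • x s, fun s hs => ⟨fun h0 h1 => ?_,
    fun h0 h1 n => by simp only [(hx s hs).2 h0 h1 n]⟩, fun s hs => ?_⟩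
  · obtain ⟨hm, hsep⟩ := (hx s hs).1 h0 h1
    refine ⟨fun n => ?_, fun n m hnm => ?_⟩
    · simp only [hm n]
      module
    · rw [← smul_sub, norm_smul, Real.norm_of_nonneg (inv_nonneg.2 hB.le), inv_mul_eq_div]
      gcongr
      exact hsep n m hnm
  · rw [mem_closedBall_zero_iff, norm_smul, Real.norm_of_nonneg (inv_nonneg.2 hB.le),
      inv_mul_eq_div, div_le_one hB]
    exact hb s hs

theorem BallContainsSprawlingTree.of_subLipschitzWith {A B : ℝ} (hB : 0 < B) {α : Ordinal.{0}}
    {f : (omegaDiamond β α).Vertex → X} (hf : (omegaDiamond β α).SubLipschitzWith A B f) :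
    BallContainsSprawlingTree β X (2 * A / B) α := by
  obtain ⟨x, hx, hb, -⟩ := exists_sprawlingTree_of_subLipschitzWith β α f hf
  exact .of_bound β hB hx hb

/-- After translation the norms are at least 1/3 and the separation is `δ / 3`, of which half is
needed. The constants do not depend on `α`. -/
theorem BallContainsSprawlingTree.exists_subLipschitzWith {δ : ℝ} (hδ : 0 < δ) {α : Ordinal.{0}}
    (hα₀ : 0 < α) (hα : α < ω_ 1) (h : BallContainsSprawlingTree β X δ α) :
    ∃ f : (omegaDiamond β α).Vertex → X,
      (omegaDiamond β α).SubLipschitzWith (min (1 / 3) (δ / 6)) 1 f := by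
  obtain ⟨u, hu⟩ := h.exists_norm_eq_one β hδ hα₀ hα
  obtain ⟨x, hx, hb⟩ := h.exists_norm_ge β hu
  obtain ⟨f, hf, -⟩ := exists_subLipschitzWith_of_sprawlingTree β (δ := δ / 3)
    (A := min (1 / 3) (δ / 6)) (B := 1) (by linarith [min_le_right (1 / 3) (δ / 6)]) α x hx
    fun s hs => ⟨(min_le_left _ _).trans (hb s hs).1, (hb s hs).2⟩
  exact ⟨f, hf⟩

theorem lt_sprawlingIndex_iff_subLipschitzEmbeds {α : Ordinal.{0}} (hα₀ : 0 < α) (hα : α < ω_ 1) :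
    (α : WithTop Ordinal.{0}) < sprawlingIndex β X ↔ (omegaDiamond β α).SubLipschitzEmbeds X := by
  rw [lt_sprawlingIndex_iff β hα]
  constructor
  · rintro ⟨δ, hδ, h⟩
    obtain ⟨f, hf⟩ := h.exists_subLipschitzWith β hδ hα₀ hα
    exact ⟨_, 1, by positivity, one_pos, f, hf⟩
  · rintro ⟨A, B, hA, hB, f, hf⟩
    exact ⟨2 * A / B, by positivity, .of_subLipschitzWith β hB hf⟩

end DiamondsAndTrees

/-! ### Bi-Lipschitz embeddings -/

section BiLipschitz

variable {X Y : Type*} [NormedAddCommGroup X] [NormedAddCommGroup Y]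

/-- The constants of a bi-Lipschitz embedding between normed spaces can be taken positive. -/
theorem BiLipschitzEmbeds.exists_norm_bounds (h : BiLipschitzEmbeds Y X) :
    ∃ (F : Y → X) (c K : ℝ), 0 < c ∧ 0 < K ∧
      ∀ u v, c * ‖u - v‖ ≤ ‖F u - F v‖ ∧ ‖F u - F v‖ ≤ K * ‖u - v‖ := by
  obtain ⟨F, K, K', hK, hK'⟩ := h
  refine ⟨F, ((K' : ℝ) + 1)⁻¹, K + 1, by positivity, by positivity, fun u v => ?_⟩
  have h1 := hK.dist_le_mul u v
  have h2 := hK'.le_mul_dist u v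
  rw [dist_eq_norm, dist_eq_norm] at h1 h2
  have h3 := norm_nonneg (u - v)
  have h4 := norm_nonneg (F u - F v)
  constructor
  · rw [inv_mul_le_iff₀ (by positivity)]
    linarith
  · linarith

variable [NormedSpace ℝ X] [NormedSpace ℝ Y]

/-- A tree in `Y` becomes a diamond, `F` carries the diamond to `X`, and there it becomes a tree
again. One new `δ` serves all `α`, so the infima compare even when infinite. -/
theorem sprawlingIndexAt_le_of_biLipschitz (β : LimitEnumeration) {F : Y → X} {c K δ : ℝ}
    (hK : 0 < K) (hF : ∀ u v, c * ‖u - v‖ ≤ ‖F u - F v‖ ∧ ‖F u - F v‖ ≤ K * ‖u - v‖)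
    (hc : 0 < c) (hδ : 0 < δ) :
    sprawlingIndexAt β Y δ ≤ sprawlingIndexAt β X (2 * (c * min (1 / 3) (δ / 6)) / K) := by
  refine le_iInf₂ fun α hα => iInf₂_le α ⟨hα.1, fun h => hα.2 ?_⟩
  -- Rank 0 is separate: it imposes no separation, so it provides no unit vector.
  rcases eq_or_ne α 0 with rfl | hα₀
  · exact ⟨fun _ => 0, isSprawlingTree_zero β _ _, fun _ _ => by simp⟩
  · obtain ⟨f, hf⟩ := h.exists_subLipschitzWith β hδ (pos_iff_ne_zero.2 hα₀) hα.1
    refine .of_subLipschitzWith β (f := F ∘ f) hK fun u v huv => ?_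
    have h1 := hF (f u) (f v)
    have h2 := hf u v huv
    constructor
    · refine le_trans ?_ h1.1
      rw [mul_assoc]
      exact mul_le_mul_of_nonneg_left h2.1 hc.le
    · refine h1.2.trans (mul_le_mul_of_nonneg_left ?_ hK.le)
      linarith [h2.2]

theorem BiLipschitzEmbeds.sprawlingIndex_le (h : BiLipschitzEmbeds Y X) (β : LimitEnumeration) :
    sprawlingIndex β Y ≤ sprawlingIndex β X := by
  obtain ⟨F, c, K, hc, hK, hF⟩ := h.exists_norm_bounds
  refine iSup₂_le fun δ (hδ : 0 < δ) => ?_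
  refine (sprawlingIndexAt_le_of_biLipschitz β hK hF hc hδ).trans ?_
  exact le_iSup₂ (f := fun (δ : ℝ) (_ : δ ∈ Set.Ioi (0 : ℝ)) => sprawlingIndexAt β X δ) _
    (show 0 < 2 * (c * min (1 / 3) (δ / 6)) / K by positivity)

/-! ### Infinite sprawling trees under bi-Lipschitz maps -/

/-- The difference quotients of `F` along the diamond spanned by the tree `y`, with bottom `p` and
scale `r`. -/
noncomputable def diffQuotientTree (F : Y → X) : Y → ℝ → (SprawlSeq → Y) → SprawlSeq → X
  | p, r, y, [] => r⁻¹ • (F (p + r • y []) - F p)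
  | p, r, y, (i, n) :: s => diffQuotientTree F
      (if i = 0 then p + (r / 2) • y [(1, n)] else p) (r / 2) (fun s => y ((i, n) :: s)) s

theorem norm_diffQuotientTree_le {F : Y → X} {K : ℝ}
    (hF : ∀ u v, ‖F u - F v‖ ≤ K * ‖u - v‖) (hK : 0 < K) (s : SprawlSeq) :
    ∀ (p : Y) {r : ℝ} (_ : 0 < r) {y : SprawlSeq → Y} (_ : ∀ s, ‖y s‖ ≤ 1),
      ‖diffQuotientTree F p r y s‖ ≤ K := by
  induction s with
  | nil =>
    intro p r hr y hy
    have := hF (p + r • y []) p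
    rw [add_sub_cancel_left, norm_smul, Real.norm_of_nonneg hr.le] at this
    rw [diffQuotientTree, norm_smul, norm_inv, Real.norm_of_nonneg hr.le, inv_mul_le_iff₀ hr]
    refine this.trans ?_
    nlinarith [mul_le_mul_of_nonneg_left (hy []) (mul_pos hK hr).le]
  | cons a s ih =>
    intro p r hr y hy
    exact ih _ (half_pos hr) fun s => hy _

/-- At the root the increment of `F` from `p` to `p + r y_∅` splits at `p + (r / 2) y_{(1,n)}`, and
the halved scale supplies the factor 1/2. Deeper nodes are roots for another base point and scale,
so `p`, `r` and `y` vary in the induction. -/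
theorem diffQuotientTree_midpoint {F : Y → X} (s : SprawlSeq) (n : ℕ) :
    ∀ (p : Y) {r : ℝ} (_ : 0 < r) {y : SprawlSeq → Y}
      (_ : ∀ s n, y s = (1 / 2 : ℝ) • (y (s ++ [(0, n)]) + y (s ++ [(1, n)]))),
      diffQuotientTree F p r y s = (1 / 2 : ℝ) • (diffQuotientTree F p r y (s ++ [(0, n)]) +
        diffQuotientTree F p r y (s ++ [(1, n)])) := by
  induction s with
  | nil =>
    intro p r hr y hy
    have h1 : p + (r / 2) • y [(1, n)] + (r / 2) • y [(0, n)] = p + r • y [] := by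
      rw [hy [] n, List.nil_append, List.nil_append]
      module
    have h2 : (r / 2)⁻¹ = 2 * r⁻¹ := by field_simp
    simp only [List.nil_append, diffQuotientTree, if_true, one_ne_zero, if_false, h1, h2]
    module
  | cons a s ih =>
    intro p r hr y hy
    exact ih _ (half_pos hr) fun s n => hy (a :: s) n

/-- The segments of the 0-successors share their upper endpoint, so only the values of `F` at the
middle points remain. These points are at least `(r / 2) δ` apart, and the quotient divides by `r /
2`. -/
theorem le_norm_diffQuotientTree_sub {F : Y → X} {c δ : ℝ} (hc : 0 ≤ c)
    (hF : ∀ u v, c * ‖u - v‖ ≤ ‖F u - F v‖) (s : SprawlSeq) {n m : ℕ} (hnm : n ≠ m) :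
    ∀ (p : Y) {r : ℝ} (_ : 0 < r) {y : SprawlSeq → Y}
      (_ : ∀ s n, y s = (1 / 2 : ℝ) • (y (s ++ [(0, n)]) + y (s ++ [(1, n)])))
      (_ : ∀ s n m, n ≠ m → δ ≤ ‖y (s ++ [(0, n)]) - y (s ++ [(0, m)])‖),
      c * δ ≤ ‖diffQuotientTree F p r y (s ++ [(0, n)]) -
        diffQuotientTree F p r y (s ++ [(0, m)])‖ := by
  induction s with
  | nil =>
    intro p r hr y hy hsep
    have h1 (n : ℕ) : p + (r / 2) • y [(1, n)] + (r / 2) • y [(0, n)] = p + r • y [] := by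
      rw [hy [] n, List.nil_append, List.nil_append]
      module
    have h2 : y [(1, m)] - y [(1, n)] = y [(0, n)] - y [(0, m)] := by
      have hn : y [(1, n)] = (2 : ℝ) • y [] - y [(0, n)] := by
        rw [hy [] n, List.nil_append, List.nil_append]
        module
      have hm : y [(1, m)] = (2 : ℝ) • y [] - y [(0, m)] := by
        rw [hy [] m, List.nil_append, List.nil_append]
        module
      rw [hn, hm, sub_sub_sub_cancel_left]
    have h3 := hF (p + (r / 2) • y [(1, m)]) (p + (r / 2) • y [(1, n)])
    rw [add_sub_add_left_eq_sub, ← smul_sub, norm_smul, h2,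
      Real.norm_of_nonneg (half_pos hr).le] at h3
    simp only [List.nil_append, diffQuotientTree, if_true, h1]
    rw [← smul_sub, sub_sub_sub_cancel_left, norm_smul, norm_inv,
      Real.norm_of_nonneg (half_pos hr).le, le_inv_mul_iff₀ (half_pos hr)]
    refine le_trans ?_ h3
    rw [mul_left_comm]
    gcongr
    exact hsep [] n m hnm
  | cons a s ih =>
    intro p r hr y hy hsep
    exact ih _ (half_pos hr) (fun s n => hy (a :: s) n) fun s n m => hsep (a :: s) n m

theorem BiLipschitzEmbeds.infiniteSprawlingTreeProperty (h : BiLipschitzEmbeds Y X)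
    (hY : InfiniteSprawlingTreeProperty Y) : InfiniteSprawlingTreeProperty X := by
  obtain ⟨F, c, K, hc, hK, hF⟩ := h.exists_norm_bounds
  obtain ⟨δ, hδ, y, hy⟩ := hY
  have hb (s : SprawlSeq) : ‖y s‖ ≤ 1 := mem_closedBall_zero_iff.1 ((hy s.length).1 s le_rfl)
  -- The conditions on the successors of `s` first appear at level `s.length + 1`.
  have hmid (s : SprawlSeq) := ((hy (s.length + 1)).2 s le_rfl).1
  have hsep (s : SprawlSeq) := ((hy (s.length + 1)).2 s le_rfl).2
  refine ⟨K⁻¹ * (c * δ), by positivity, fun s => K⁻¹ • diffQuotientTree F 0 1 y s, fun k =>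
    ⟨fun s _ => ?_, fun s _ => ⟨fun n => ?_, fun n m hnm => ?_⟩⟩⟩
  · rw [mem_closedBall_zero_iff, norm_smul, norm_inv, Real.norm_of_nonneg hK.le,
      inv_mul_le_iff₀ hK, mul_one]
    exact norm_diffQuotientTree_le (fun u v => (hF u v).2) hK s 0 one_pos hb
  · dsimp only
    rw [diffQuotientTree_midpoint s n 0 one_pos hmid]
    module
  · rw [← smul_sub, norm_smul, norm_inv, Real.norm_of_nonneg hK.le]
    gcongr
    exact le_norm_diffQuotientTree_sub hc.le (fun u v => (hF u v).1) s hnm 0 one_pos hmid hsep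

end BiLipschitz

theorem theoremB {X Y : Type*}
    [NormedAddCommGroup X] [NormedSpace ℝ X] [CompleteSpace X] [TopologicalSpace.SeparableSpace X]
    [NormedAddCommGroup Y] [NormedSpace ℝ Y] [CompleteSpace Y]
    (hYX : BiLipschitzEmbeds Y X)
    (β : LimitEnumeration) (α : Ordinal.{0}) (hα₀ : 0 < α) (hα : α < Ordinal.omega 1) :
    ((α : WithTop Ordinal.{0}) < sprawlingIndex β X ↔ (omegaDiamond β α).SubLipschitzEmbeds X) ∧
    sprawlingIndex β Y ≤ sprawlingIndex β X ∧
    (¬ InfiniteSprawlingTreeProperty X → ¬ InfiniteSprawlingTreeProperty Y) :=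
  ⟨lt_sprawlingIndex_iff_subLipschitzEmbeds β hα₀ hα, hYX.sprawlingIndex_le β,
    mt hYX.infiniteSprawlingTreeProperty⟩
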